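/- Let $N\in\mathbb N=\{0,1,2,\dots\}$ and let $H(N,2)$ be the $N$-cube: its vertex set $X$ is the set of $N$-tuples with entries in $\{1,-1\}$, and two vertices are adjacent when they differ in exactly one coordinate. Let $\partial$ be the path-length distance, let $G$ be the automorphism group of $H(N,2)$, and let $V$ be the complex vector space with basis $X$, on which $G$ acts by permuting the basis. Let $G$ act on $V^{\otimes 3}=V\otimes V\otimes V$ by $g(u\otimes v\otimes w)=g(u)\otimes g(v)\otimes g(w)$ and put ${\rm Fix}(G)=\{v\in V^{\otimes 3} \mid g(v)=v \ \forall g\in G\}$. A Hermitian form is linear in its first argument and conjugate symmetric. Equip $V^{\otimes 3}$ with the Hermitian form $\langle\,,\,\rangle$ for which the basis $\{x\otimes y\otimes z\}_{x,y,z\in X}$ is orthonormal, and ${\rm End}(V)$ with the Hermitian form $\langle\,,\,\rangle$ for which the basis $\{e_{x,y}\}_{x,y\in X}$ is orthonormal, where $e_{x,y}$ sends $y\mapsto x$ and all other vertices to $0$. Fix $\varkappa\in X$. Let ${\sf A}\in{\rm End}(V)$ send each $x\in X$ to the sum of its neighbours, let ${\sf A}^*\in{\rm End}(V)$ send each $x\in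 X$ to $(N-2\partial(x,\varkappa))\,x$, and let $T$ be the subalgebra (with the same identity) of ${\rm End}(V)$ generated by ${\sf A},{\sf A}^*$. Let $\varepsilon:V^{\otimes 3}\to{\rm End}(V)$ be the $\mathbb C$-linear map such that, for $x,y,z\in X$, $\varepsilon(x\otimes y\otimes z)=2^{N/2}e_{y,z}$ if $x=\varkappa$ and $\varepsilon(x\otimes y\otimes z)=0$ if $x\neq\varkappa$. Then $\varepsilon$ restricts to a bijection (hence an isomorphism of vector spaces) ${\rm Fix}(G)\to T$, and $$\langle u,v\rangle=\langle\varepsilon(u),\varepsilon(v)\rangle\qquad\text{for all } u,v\in{\rm Fix}(G).$$ -/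

import Mathlib

open scoped TensorProduct

noncomputable section

namespace Hypercube

/-! ### Hermitian forms -/

/-- `F` is a Hermitian form on the complex vector space `W`: additive and homogeneous in the first
argument, and conjugate symmetric. -/
structure IsHermitianForm {W : Type*} [AddCommMonoid W] [Module ℂ W] (F : W → W → ℂ) : Prop where
  add_left : ∀ f g h, F (f + g) h = F f h + F g h
  smul_left : ∀ (a : ℂ) (f g : W), F (a • f) g = a * F f g
  conj_symm : ∀ f g, F f g = (starRingEnd ℂ) (F g f)

/-- The Hermitian form on `W` with respect to which the given finite basis is orthonormal. -/
def orthonormalForm {ι W : Type*} [Fintype ι] [AddCommMonoid W] [Module ℂ W]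
    (b : Module.Basis ι ℂ W) (u v : W) : ℂ :=
  ∑ i, b.repr u i * (starRingEnd ℂ) (b.repr v i)

theorem orthonormalForm_isHermitianForm {ι W : Type*} [Fintype ι] [AddCommMonoid W] [Module ℂ W]
    (b : Module.Basis ι ℂ W) : IsHermitianForm (orthonormalForm b) where
  add_left f g h := by simp [orthonormalForm, add_mul, Finset.sum_add_distrib]
  smul_left a f g := by simp [orthonormalForm, Finset.mul_sum, mul_assoc]
  conj_symm f g := by simp [orthonormalForm, mul_comm]

theorem orthonormalForm_basis {ι W : Type*} [Fintype ι] [DecidableEq ι] [AddCommMonoid W]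
    [Module ℂ W] (b : Module.Basis ι ℂ W) (i j : ι) :
    orthonormalForm b (b i) (b j) = if i = j then 1 else 0 := by
  classical
  simp [orthonormalForm, Finsupp.single_apply]

/-- The form is the only Hermitian form for which the basis is orthonormal. -/
theorem orthonormalForm_unique {ι W : Type*} [Fintype ι] [DecidableEq ι] [AddCommMonoid W]
    [Module ℂ W] (b : Module.Basis ι ℂ W) (F : W → W → ℂ) (hF : IsHermitianForm F)
    (hb : ∀ i j, F (b i) (b j) = if i = j then 1 else 0) : F = orthonormalForm b := by
  have key : ∀ (F : W → W → ℂ), IsHermitianForm F →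
      (∀ i j, F (b i) (b j) = if i = j then 1 else 0) →
      ∀ u v, F u v = orthonormalForm b u v := by
    intro F hF hb u v
    let L : W → (W →ₗ[ℂ] ℂ) := fun v =>
      { toFun := fun u => F u v
        map_add' := fun f g => hF.add_left f g v
        map_smul' := fun a f => hF.smul_left a f v }
    have h1 : ∀ u v, F u v = ∑ i, b.repr u i * F (b i) v := by
      intro u v
      have : L v u = ∑ i, b.repr u i * L v (b i) := by
        conv_lhs => rw [← b.sum_repr u]
        rw [map_sum]
        simp only [map_smul, smul_eq_mul]
      exact this
    rw [h1]
    refine Finset.sum_congr rfl fun i _ => ?_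
    rw [hF.conj_symm, h1]
    simp [hb]
  funext u v
  exact key F hF hb u v

/-! ### The hypercube `H(N,2)` -/

/-- The vertex set of `H(N,2)`: the `N`-tuples of elements of `{1,-1}` (the units of `ℤ`). -/
abbrev Vertex (N : ℕ) : Type := Fin N → ℤˣ

/-- The graph `H(N,2)`: vertices are adjacent when they differ in exactly one coordinate. -/
def cube (N : ℕ) : SimpleGraph (Vertex N) where
  Adj x y := hammingDist x y = 1
  symm := ⟨fun x y h => by rwa [hammingDist_comm]⟩
  loopless := ⟨fun x h => by simp at h⟩

instance (N : ℕ) : DecidableRel (cube N).Adj :=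
  fun x y => inferInstanceAs (Decidable (hammingDist x y = 1))

/-- The standard module: the complex vector space with basis the vertex set. -/
abbrev V (N : ℕ) : Type := Vertex N →₀ ℂ

/-- The vertex `x` as an element of the standard module. -/
abbrev vtx {N : ℕ} (x : Vertex N) : V N := Finsupp.single x 1

/-- The vertices as a basis of the standard module. -/
abbrev stdBasis (N : ℕ) : Module.Basis (Vertex N) ℂ (V N) := Finsupp.basisSingleOne

/-- The threefold tensor power of the standard module. -/
abbrev V3 (N : ℕ) : Type := V N ⊗[ℂ] (V N ⊗[ℂ] V N)

/-- The basis of `V3 N` consisting of the vectors `x ⊗ y ⊗ z` with `x, y, z` vertices. -/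
def tensorBasis (N : ℕ) : Module.Basis (Vertex N × Vertex N × Vertex N) ℂ (V3 N) :=
  (stdBasis N).tensorProduct ((stdBasis N).tensorProduct (stdBasis N))

theorem tensorBasis_apply {N : ℕ} (x y z : Vertex N) :
    tensorBasis N (x, y, z) = vtx x ⊗ₜ[ℂ] (vtx y ⊗ₜ[ℂ] vtx z) := by
  simp [tensorBasis, Module.Basis.tensorProduct_apply]

/-- The Hermitian form on `V3 N` for which the vectors `x ⊗ y ⊗ z` are orthonormal. -/
def tensorForm (N : ℕ) : V3 N → V3 N → ℂ := orthonormalForm (tensorBasis N)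

/-! ### The fixed space of the automorphism group -/

/-- The action on `V N` of a graph automorphism `g`: it sends the vertex `x` to `g x`. -/
def autV {N : ℕ} (g : cube N ≃g cube N) : V N →ₗ[ℂ] V N := Finsupp.lmapDomain ℂ ℂ g

theorem autV_vtx {N : ℕ} (g : cube N ≃g cube N) (x : Vertex N) : autV g (vtx x) = vtx (g x) := by
  simp [autV]

/-- The action on `V3 N` of a graph automorphism: `g (u ⊗ v ⊗ w) = g u ⊗ g v ⊗ g w`. -/
def autV3 {N : ℕ} (g : cube N ≃g cube N) : V3 N →ₗ[ℂ] V3 N :=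
  TensorProduct.map (autV g) (TensorProduct.map (autV g) (autV g))

/-- `Fix(G)`, where `G` is the full automorphism group of `H(N,2)`. -/
def Fix (N : ℕ) : Submodule ℂ (V3 N) where
  carrier := {v | ∀ g : cube N ≃g cube N, autV3 g v = v}
  zero_mem' := fun g => map_zero _
  add_mem' := fun {a b} ha hb g => by rw [map_add, ha g, hb g]
  smul_mem' := fun c v hv g => by rw [map_smul, hv g]

/-! ### The subconstituent algebra -/

/-- The adjacency map: it sends a vertex to the sum of its neighbours. -/
def adjMap (N : ℕ) : Module.End ℂ (V N) :=
  (stdBasis N).constr ℂ fun x => ∑ ξ ∈ (cube N).neighborFinset x, vtx ξ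

/-- The dual adjacency map with respect to `κ`: it multiplies the vertex `x` by `N - 2 ∂(x, κ)`,
where `∂` is the path-length distance. -/
def dualAdjMap {N : ℕ} (κ : Vertex N) : Module.End ℂ (V N) :=
  (stdBasis N).constr ℂ fun x => ((N : ℂ) - 2 * ((cube N).dist x κ : ℂ)) • vtx x

/-- The subconstituent (Terwilliger) algebra of `H(N,2)` with respect to `κ`. -/
def T {N : ℕ} (κ : Vertex N) : Subalgebra ℂ (Module.End ℂ (V N)) :=
  Algebra.adjoin ℂ {adjMap N, dualAdjMap κ}

/-- The map `e_{x,y}` sending `y` to `x` and all other vertices to `0`. -/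
def e {N : ℕ} (x y : Vertex N) : Module.End ℂ (V N) :=
  (stdBasis N).constr ℂ fun z => if z = y then vtx x else 0

/-- The maps `e_{x,y}` as a basis of `End(V)`. -/
def endBasis (N : ℕ) : Module.Basis (Vertex N × Vertex N) ℂ (Module.End ℂ (V N)) :=
  (stdBasis N).linearMap (stdBasis N)

theorem endBasis_apply {N : ℕ} (x y : Vertex N) : endBasis N (x, y) = e x y := by
  refine (stdBasis N).ext fun z => ?_
  rw [endBasis, Module.Basis.linearMap_apply_apply, e, Module.Basis.constr_basis]
  simp [eq_comm]

/-- The Hermitian form on `End(V)` for which the maps `e_{x,y}` are orthonormal. -/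
def endForm (N : ℕ) : Module.End ℂ (V N) → Module.End ℂ (V N) → ℂ := orthonormalForm (endBasis N)

/-- The linear map `ε : V ⊗ V ⊗ V → End(V)` with `ε (x ⊗ y ⊗ z) = 2^{N/2} e_{y,z}` if `x = κ`, and
`ε (x ⊗ y ⊗ z) = 0` if `x ≠ κ`, for vertices `x, y, z`. -/
def epsilon {N : ℕ} (κ : Vertex N) : V3 N →ₗ[ℂ] Module.End ℂ (V N) :=
  (tensorBasis N).constr ℂ fun p =>
    if p.1 = κ then (((2 : ℝ) ^ ((N : ℝ) / 2) : ℝ) : ℂ) • e p.2.1 p.2.2 else 0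

theorem epsilon_apply {N : ℕ} (κ x y z : Vertex N) :
    epsilon κ (vtx x ⊗ₜ[ℂ] (vtx y ⊗ₜ[ℂ] vtx z)) =
      if x = κ then (((2 : ℝ) ^ ((N : ℝ) / 2) : ℝ) : ℂ) • e y z else 0 := by
  rw [← tensorBasis_apply, epsilon, Module.Basis.constr_basis]

end Hypercube

end

/-! A tensor is fixed by G exactly when its coefficients are constant on G-orbits of triples of
vertices (`mem_Fix_iff`). G is transitive on vertices, so such a tensor is determined by its slice
with first vertex κ, and `epsilon` reads that slice, scaled by 2^{N/2}, as a matrix invariant under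
the stabilizer of κ. It remains to see that these invariant matrices form `T κ`.

Both generators commute with the stabilizer, hence so does all of `T κ`. Conversely, the
stabilizer's orbits on pairs (y, z) are classified by the three distances among κ, y, z
(`exists_aut_of_dist_eq`), so an invariant matrix is a combination of products E_i A_h E_j of
distance maps and projections onto the spheres around κ. All these factors lie in `T κ`
(`mem_T_of_entries`).

For the forms, the 2^N slices of a fixed tensor contribute equally, and 2^N is the square of the
scaling factor. -/

open scoped TensorProduct

noncomputable section

namespace Hypercube

variable {N : ℕ}

/-! ### The path-length distance -/

/-- Negate the coordinate `i`. -/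
def flip (x : Vertex N) (i : Fin N) : Vertex N := Function.update x i (-x i)

theorem units_ne_neg (a : ℤˣ) : a ≠ -a := by
  rcases Int.units_eq_one_or a with h | h <;> subst h <;> decide

theorem units_eq_neg_of_ne {a b : ℤˣ} (h : a ≠ b) : b = -a := by
  rcases Int.units_eq_one_or a with ha | ha <;> rcases Int.units_eq_one_or b with hb | hb <;>
    subst ha <;> subst hb <;> simp_all

theorem flip_flip (x : Vertex N) (i : Fin N) : flip (flip x i) i = x := by
  simp [flip]

theorem hammingDist_flip_of_ne {x y : Vertex N} {i : Fin N} (h : x i ≠ y i) :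
    hammingDist x y = hammingDist (flip x i) y + 1 := by
  have : Finset.univ.filter (fun j => x j ≠ y j) =
      insert i (Finset.univ.filter fun j => flip x i j ≠ y j) := by
    ext j
    simp only [Finset.mem_insert, Finset.mem_filter, Finset.mem_univ, true_and]
    by_cases hj : j = i
    · subst hj; simp [h]
    · simp [flip, hj]
  rw [hammingDist, this, Finset.card_insert_of_notMem, hammingDist]
  simp only [Finset.mem_filter, Finset.mem_univ, true_and]
  simp [flip, units_eq_neg_of_ne h]

theorem hammingDist_flip_of_eq {x y : Vertex N} {i : Fin N} (h : x i = y i) :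
    hammingDist (flip x i) y = hammingDist x y + 1 := by
  have h' : flip x i i ≠ y i := by simp [flip, ← h, (units_ne_neg (x i)).symm]
  rw [hammingDist_flip_of_ne h', flip_flip]

theorem cube_adj_flip (x : Vertex N) (i : Fin N) : (cube N).Adj x (flip x i) := by
  change hammingDist x (flip x i) = 1
  rw [hammingDist_comm, hammingDist_flip_of_eq rfl, hammingDist_self]

theorem cube_adj_iff {x y : Vertex N} : (cube N).Adj x y ↔ ∃ i, y = flip x i := by
  constructor
  · intro h
    change hammingDist x y = 1 at h
    obtain ⟨i, hi⟩ : ∃ i, x i ≠ y i := by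
      by_contra! hc
      simp [funext hc] at h
    rw [hammingDist_flip_of_ne hi] at h
    exact ⟨i, (hammingDist_eq_zero.1 (by omega)).symm⟩
  · rintro ⟨i, rfl⟩
    exact cube_adj_flip x i

theorem flip_injective (x : Vertex N) : Function.Injective (flip x) := by
  intro i j h
  by_contra hij
  have := congrFun h i
  simp only [flip, Function.update_self, Function.update_of_ne hij] at this
  exact units_ne_neg (x i) this.symm

theorem cube_neighborFinset (x : Vertex N) :
    (cube N).neighborFinset x = Finset.univ.map ⟨flip x, flip_injective x⟩ := by
  ext y
  simp [cube_adj_iff, eq_comm]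

theorem exists_walk_length_eq_hammingDist (n : ℕ) :
    ∀ x y : Vertex N, hammingDist x y = n → ∃ p : (cube N).Walk x y, p.length = n := by
  induction n with
  | zero =>
    intro x y h
    obtain rfl := hammingDist_eq_zero.1 h
    exact ⟨.nil, rfl⟩
  | succ n ih =>
    intro x y h
    obtain ⟨i, hi⟩ : ∃ i, x i ≠ y i := by
      by_contra! hc
      simp [funext hc] at h
    rw [hammingDist_flip_of_ne hi] at h
    obtain ⟨p, hp⟩ := ih (flip x i) y (by omega)
    exact ⟨.cons (cube_adj_flip x i) p, by simp [hp]⟩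

theorem hammingDist_le_walk_length {x y : Vertex N} (p : (cube N).Walk x y) :
    hammingDist x y ≤ p.length := by
  induction p with
  | nil => simp
  | @cons u v w h p ih =>
    have h1 : hammingDist u v = 1 := h
    have := hammingDist_triangle u v w
    rw [SimpleGraph.Walk.length_cons]
    omega

/-- Correcting the differing coordinates one at a time gives a walk of length `hammingDist x y`; no
walk is shorter, since an edge changes one coordinate. -/
theorem cube_dist (x y : Vertex N) : (cube N).dist x y = hammingDist x y := by
  obtain ⟨p, hp⟩ := exists_walk_length_eq_hammingDist _ x y rfl
  refine le_antisymm (hp ▸ SimpleGraph.dist_le p) ?_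
  obtain ⟨q, hq⟩ := SimpleGraph.Reachable.exists_walk_length_eq_dist ⟨p⟩
  exact hq ▸ hammingDist_le_walk_length q

/-- A shortest walk maps to a walk of the same length, so neither `g` nor its inverse increases
distance. -/
theorem hammingDist_aut (g : cube N ≃g cube N) (x y : Vertex N) :
    hammingDist (g x) (g y) = hammingDist x y := by
  have h : ∀ (g : cube N ≃g cube N) (x y : Vertex N),
      hammingDist (g x) (g y) ≤ hammingDist x y := by
    intro g x y
    obtain ⟨p, hp⟩ := exists_walk_length_eq_hammingDist _ x y rfl
    rw [← hp, ← SimpleGraph.Walk.length_map g.toHom p]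
    exact hammingDist_le_walk_length _
  refine le_antisymm (h g x y) ?_
  simpa using h g.symm (g x) (g y)

theorem hammingDist_le (x y : Vertex N) : hammingDist x y ≤ N := by
  simpa using hammingDist_le_card_fintype (x := x) (y := y)

/-! ### Automorphisms -/

/-- A permutation of the vertices that preserves the Hamming distance is an automorphism. -/
def autOfIsometry (f : Vertex N ≃ Vertex N)
    (hf : ∀ x y, hammingDist (f x) (f y) = hammingDist x y) : cube N ≃g cube N where
  toEquiv := f
  map_rel_iff' := by
    intro x y
    change hammingDist (f x) (f y) = 1 ↔ hammingDist x y = 1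
    rw [hf]

/-- Coordinatewise multiplication by a vertex. -/
def translation (a : Vertex N) : cube N ≃g cube N :=
  autOfIsometry (Equiv.mulLeft a) fun x y => by simp [hammingDist]

@[simp] theorem translation_apply (a x : Vertex N) : translation a x = a * x := rfl

/-- Permutation of the coordinates. -/
def coordPerm (σ : Equiv.Perm (Fin N)) : cube N ≃g cube N :=
  autOfIsometry (σ.arrowCongr (Equiv.refl ℤˣ)).symm fun x y => by
    rw [hammingDist, hammingDist]
    refine Finset.card_equiv σ fun i => ?_
    simp [Equiv.arrowCongr]

@[simp] theorem coordPerm_one (σ : Equiv.Perm (Fin N)) : coordPerm σ 1 = 1 := rfl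

theorem mul_self_vertex (a : Vertex N) : a * a = 1 := by
  funext i
  simp

theorem exists_aut_map_eq (x κ : Vertex N) : ∃ g : cube N ≃g cube N, g x = κ := by
  refine ⟨translation (κ * x), ?_⟩
  rw [translation_apply, mul_assoc, mul_self_vertex, mul_one]

-- The three distances and N determine the four counts of coordinates with prescribed signs: they
-- form an invertible linear system in those counts.
open Finset in
theorem card_fiber_eq {y z y' z' : Vertex N} (hy : hammingDist y 1 = hammingDist y' 1)
    (hz : hammingDist z 1 = hammingDist z' 1) (hyz : hammingDist y z = hammingDist y' z')
    (a b : ℤˣ) : #{i | (y i, z i) = (a, b)} = #{i | (y' i, z' i) = (a, b)} := by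
  have key : ∀ y z : Vertex N,
      hammingDist y 1 = #{i | (y i, z i) = (-1, 1)} + #{i | (y i, z i) = (-1, -1)} ∧
      hammingDist z 1 = #{i | (y i, z i) = (1, -1)} + #{i | (y i, z i) = (-1, -1)} ∧
      hammingDist y z = #{i | (y i, z i) = (-1, 1)} + #{i | (y i, z i) = (1, -1)} ∧
      N = #{i | (y i, z i) = (1, 1)} + #{i | (y i, z i) = (1, -1)} +
        #{i | (y i, z i) = (-1, 1)} + #{i | (y i, z i) = (-1, -1)} := by
    intro y z
    have hN : N = ∑ _i : Fin N, 1 := by simp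
    simp only [hammingDist, card_filter, ← sum_add_distrib]
    refine ⟨sum_congr rfl fun i _ => ?_, sum_congr rfl fun i _ => ?_,
      sum_congr rfl fun i _ => ?_, hN.trans (sum_congr rfl fun i _ => ?_)⟩ <;>
    · rcases Int.units_eq_one_or (y i) with h | h <;>
        rcases Int.units_eq_one_or (z i) with h' | h' <;> simp [h, h']
  obtain ⟨h1, h2, h3, h4⟩ := key y z
  obtain ⟨h1', h2', h3', h4'⟩ := key y' z'
  rcases Int.units_eq_one_or a with rfl | rfl <;> rcases Int.units_eq_one_or b with rfl | rfl <;>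
    omega

/-- Equal counts allow coordinates with the same sign pattern to be matched; gluing the four
bijections gives σ. -/
theorem exists_coordPerm {y z y' z' : Vertex N} (hy : hammingDist y 1 = hammingDist y' 1)
    (hz : hammingDist z 1 = hammingDist z' 1) (hyz : hammingDist y z = hammingDist y' z') :
    ∃ σ : Equiv.Perm (Fin N), coordPerm σ y' = y ∧ coordPerm σ z' = z := by
  have h : ∀ c : ℤˣ × ℤˣ,
      Nonempty ({i // (y i, z i) = c} ≃ {i // (y' i, z' i) = c}) := by
    rintro ⟨a, b⟩
    refine ⟨Fintype.equivOfCardEq ?_⟩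
    rw [Fintype.card_subtype, Fintype.card_subtype]
    exact card_fiber_eq hy hz hyz a b
  let σ := Equiv.ofFiberEquiv fun c => (h c).some
  have hσ : ∀ i, (y' (σ i), z' (σ i)) = (y i, z i) := fun i =>
    Equiv.ofFiberEquiv_map (fun c => (h c).some) i
  exact ⟨σ, funext fun i => congrArg Prod.fst (hσ i), funext fun i => congrArg Prod.snd (hσ i)⟩

/-- The stabilizer of `κ` is transitive on the pairs of vertices with given mutual distances. -/
theorem exists_aut_of_dist_eq {κ y z y' z' : Vertex N}
    (hy : hammingDist y κ = hammingDist y' κ) (hz : hammingDist z κ = hammingDist z' κ)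
    (hyz : hammingDist y z = hammingDist y' z') :
    ∃ g : cube N ≃g cube N, g κ = κ ∧ g y' = y ∧ g z' = z := by
  have ht : ∀ u v : Vertex N, hammingDist (κ * u) (κ * v) = hammingDist u v :=
    fun u v => hammingDist_aut (translation κ) u v
  have hκ : κ * κ = 1 := mul_self_vertex κ
  have h1 : ∀ u : Vertex N, hammingDist (κ * u) 1 = hammingDist u κ := fun u => by
    rw [← hκ, ht]
  obtain ⟨σ, hσy, hσz⟩ := exists_coordPerm (y := κ * y) (z := κ * z) (y' := κ * y') (z' := κ * z')
    (by rw [h1, h1, hy]) (by rw [h1, h1, hz]) (by rw [ht, ht, hyz])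
  -- Conjugation by translation by κ, an involution, turns a coordinate permutation, which fixes 1,
  -- into an automorphism fixing κ.
  refine ⟨((translation κ).trans (coordPerm σ)).trans (translation κ), ?_, ?_, ?_⟩
  · simp [hκ]
  · simp [hσy, ← mul_assoc, hκ]
  · simp [hσz, ← mul_assoc, hκ]

/-! ### Matrix entries -/

theorem end_ext {M M' : Module.End ℂ (V N)} (h : ∀ y z, M (vtx z) y = M' (vtx z) y) : M = M' :=
  (stdBasis N).ext fun z => by
    simpa using Finsupp.ext fun y => h y z

theorem endBasis_repr (M : Module.End ℂ (V N)) (y z : Vertex N) :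
    (endBasis N).repr M (y, z) = M (vtx z) y := by
  have h : (endBasis N).coord (y, z) = Finsupp.lapply y ∘ₗ LinearMap.applyₗ (vtx z) := by
    refine (endBasis N).ext ?_
    rintro ⟨a, b⟩
    have hab : endBasis N (a, b) (vtx z) = if b = z then vtx a else 0 := by
      have := (stdBasis N).linearMap_apply_apply (stdBasis N) (a, b) z
      simpa [endBasis, Finsupp.coe_basisSingleOne] using this
    rw [LinearMap.comp_apply, LinearMap.applyₗ_apply_apply, hab]
    by_cases hb : b = z <;> simp [hb, Finsupp.single_apply]
  exact LinearMap.congr_fun h M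

theorem adjMap_vtx (z : Vertex N) : adjMap N (vtx z) = ∑ i, vtx (flip z i) := by
  have h := (stdBasis N).constr_basis ℂ
    (fun x => ∑ ξ ∈ (cube N).neighborFinset x, (vtx ξ : V N)) z
  rw [Finsupp.coe_basisSingleOne] at h
  rw [adjMap, h, cube_neighborFinset, Finset.sum_map]
  rfl

theorem dualAdjMap_vtx (κ z : Vertex N) :
    dualAdjMap κ (vtx z) = ((N : ℂ) - 2 * (hammingDist z κ : ℂ)) • vtx z := by
  have h := (stdBasis N).constr_basis ℂ
    (fun x => ((N : ℂ) - 2 * ((cube N).dist x κ : ℂ)) • (vtx x : V N)) z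
  rw [Finsupp.coe_basisSingleOne] at h
  rw [dualAdjMap, h, cube_dist]

/-! ### The distance maps -/

/-- The `h`-th distance map: it sends a vertex to the sum of the vertices at distance `h`. -/
def distMap (N h : ℕ) : Module.End ℂ (V N) :=
  (stdBasis N).constr ℂ fun x => ∑ y with hammingDist x y = h, vtx y

theorem distMap_apply (h : ℕ) (y z : Vertex N) :
    distMap N h (vtx z) y = if hammingDist z y = h then 1 else 0 := by
  have h := (stdBasis N).constr_basis ℂ
    (fun x => ∑ y with hammingDist x y = h, (vtx y : V N)) z
  rw [Finsupp.coe_basisSingleOne] at h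
  rw [distMap, h, Finsupp.finsetSum_apply]
  simp [Finsupp.single_apply]

theorem distMap_zero : distMap N 0 = 1 :=
  end_ext fun y z => by simp [distMap_apply, Finsupp.single_apply]

theorem distMap_mul_adjMap_apply (h : ℕ) (y z : Vertex N) :
    (distMap N h * adjMap N) (vtx z) y =
      ∑ i, if hammingDist (flip z i) y = h then 1 else 0 := by
  rw [Module.End.mul_apply, adjMap_vtx, map_sum, Finsupp.finsetSum_apply]
  simp only [distMap_apply]

theorem distMap_one : distMap N 1 = adjMap N := by
  rw [← one_mul (adjMap N), ← distMap_zero]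
  refine end_ext fun y z => ?_
  rw [distMap_apply, distMap_mul_adjMap_apply]
  simp only [hammingDist_eq_zero]
  split_ifs with h
  · obtain ⟨i, rfl⟩ := cube_adj_iff.1 (show (cube N).Adj z y from h)
    simp [(flip_injective z).eq_iff]
  · rw [Finset.sum_eq_zero]
    intro i _
    rw [if_neg]
    rintro rfl
    exact h (cube_adj_flip z i)

/-- A neighbour of z lies at distance h + 1 from y either by flipping one of h + 2 differing
coordinates, or by flipping one of N - h agreeing ones. -/
theorem distMap_mul_adjMap (h : ℕ) :
    distMap N (h + 1) * adjMap N =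
      ((h : ℂ) + 2) • distMap N (h + 2) + ((N : ℂ) - h) • distMap N h := by
  refine end_ext fun y z => ?_
  have key : ∀ i, (if hammingDist (flip z i) y = h + 1 then (1 : ℂ) else 0) =
      (if z i ≠ y i then 1 else 0) * (if hammingDist z y = h + 2 then 1 else 0) +
      (1 - if z i ≠ y i then 1 else 0) * (if hammingDist z y = h then 1 else 0) := by
    intro i
    by_cases hi : z i = y i
    · simp [hammingDist_flip_of_eq hi, hi]
    · simp [hammingDist_flip_of_ne hi, hi]
  have hd : ∑ i, (if z i ≠ y i then (1 : ℂ) else 0) = hammingDist z y := by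
    rw [hammingDist, Finset.sum_boole]
  rw [distMap_mul_adjMap_apply, Finset.sum_congr rfl fun i _ => key i, Finset.sum_add_distrib,
    ← Finset.sum_mul, ← Finset.sum_mul, Finset.sum_sub_distrib, hd]
  simp only [LinearMap.add_apply, LinearMap.smul_apply, Finsupp.add_apply, Finsupp.smul_apply,
    distMap_apply, smul_eq_mul, Finset.sum_const, Finset.card_univ, Fintype.card_fin, nsmul_eq_mul,
    mul_one]
  congr 1
  · split_ifs with h'
    · rw [h']; push_cast; ring
    · simp
  · split_ifs with h'
    · rw [h']
    · simp

theorem adjMap_mem_T (κ : Vertex N) : adjMap N ∈ T κ :=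
  Algebra.subset_adjoin (by simp)

theorem distMap_mem_T (κ : Vertex N) (h : ℕ) : distMap N h ∈ T κ := by
  -- The recurrence has three terms, so the induction carries two consecutive distance maps; its
  -- leading coefficient h + 2 is invertible.
  suffices H : distMap N h ∈ T κ ∧ distMap N (h + 1) ∈ T κ from H.1
  induction h with
  | zero =>
    rw [distMap_zero, zero_add, distMap_one]
    exact ⟨one_mem _, adjMap_mem_T κ⟩
  | succ h ih =>
    refine ⟨ih.2, ?_⟩
    have h2 : (h : ℂ) + 2 ≠ 0 := by exact_mod_cast (Nat.succ_ne_zero (h + 1))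
    have : distMap N (h + 1 + 1) = ((h : ℂ) + 2)⁻¹ •
        (distMap N (h + 1) * adjMap N + (-((N : ℂ) - h)) • distMap N h) := by
      rw [distMap_mul_adjMap, add_assoc (_ • _), ← add_smul, add_neg_cancel, zero_smul, add_zero, inv_smul_smul₀ h2]
    rw [this]
    exact (T κ).smul_mem
      (add_mem (mul_mem ih.2 (adjMap_mem_T κ)) ((T κ).smul_mem ih.1 _)) _

/-! ### The dual idempotents -/

/-- There is a projection in `T` onto the span of the vertices at distance `i` from `κ`. -/
theorem exists_dualIdempotent (κ : Vertex N) (i : ℕ) : ∃ E ∈ T κ, ∀ z : Vertex N,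
    E (vtx z) = (if hammingDist z κ = i then (1 : ℂ) else 0) • vtx z := by
  let θ : ℕ → ℂ := fun k => (N : ℂ) - 2 * k
  have hθ : Set.InjOn θ (Finset.range (N + 1)) := by
    intro a _ b _ h
    simpa [θ] using h
  -- Interpolation at the distinct eigenvalues N - 2k of `dualAdjMap κ`, with value 1 only at k = i.
  -- For i > N all values are 0, and no vertex is at distance i.
  let p := Lagrange.interpolate (Finset.range (N + 1)) θ fun k => if k = i then (1 : ℂ) else 0
  refine ⟨Polynomial.aeval (dualAdjMap κ) p, ?_, fun z => ?_⟩
  · exact Algebra.adjoin_mono (by simp) (Polynomial.aeval_mem_adjoin_singleton ℂ (dualAdjMap κ))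
  · have hv : (dualAdjMap κ).HasEigenvector (θ (hammingDist z κ)) (vtx z) := by
      rw [Module.End.hasEigenvector_iff, Module.End.mem_eigenspace_iff]
      exact ⟨dualAdjMap_vtx κ z, by simp⟩
    rw [Module.End.aeval_apply_of_hasEigenvector hv, Lagrange.eval_interpolate_at_node _ hθ]
    exact Finset.mem_range.2 (Nat.lt_succ_of_le (hammingDist_le z κ))

/-- A map whose entries depend only on the mutual distances of `κ`, `y`, `z` lies in `T`. -/
theorem mem_T_of_entries {κ : Vertex N} {M : Module.End ℂ (V N)} (F : ℕ × ℕ × ℕ → ℂ)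
    (hM : ∀ y z, M (vtx z) y = F (hammingDist y κ, hammingDist z κ, hammingDist z y)) :
    M ∈ T κ := by
  choose E hE hEv using exists_dualIdempotent κ
  have hEl : ∀ (i : ℕ) (v : V N) (y : Vertex N),
      E i v y = (if hammingDist y κ = i then 1 else 0) * v y := by
    intro i v y
    induction v using Finsupp.induction_linear with
    | zero => simp
    | add f g hf hg => rw [map_add, Finsupp.add_apply, hf, hg, Finsupp.add_apply, mul_add]
    | single x c =>
      have : (Finsupp.single x c : V N) = c • vtx x := by simp
      rw [this, map_smul, hEv]
      by_cases hxy : x = y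
      · subst hxy
        by_cases hx : hammingDist x κ = i <;> simp [hx]
      · by_cases hx : hammingDist x κ = i <;> simp [hx, hxy]
  let S := Finset.range (N + 1)
  -- At each entry (y, z) exactly one summand is nonzero, the one indexed by the distances of κ, y,
  -- z.
  have hsum : M = ∑ p ∈ S ×ˢ S ×ˢ S, F p • (E p.1 * distMap N p.2.2 * E p.2.1) := by
    refine end_ext fun y z => ?_
    have hterm : ∀ p : ℕ × ℕ × ℕ, (F p • (E p.1 * distMap N p.2.2 * E p.2.1)) (vtx z) y =
        if p = (hammingDist y κ, hammingDist z κ, hammingDist z y) then F p else 0 := by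
      rintro ⟨i, j, h⟩
      simp only [LinearMap.smul_apply, Module.End.mul_apply, Finsupp.smul_apply, smul_eq_mul]
      rw [hEl, hEv, map_smul, Finsupp.smul_apply, distMap_apply]
      simp only [Prod.mk.injEq, eq_comm (a := i), eq_comm (a := j), eq_comm (a := h)]
      by_cases h1 : hammingDist y κ = i <;> by_cases h2 : hammingDist z κ = j <;>
        by_cases h3 : hammingDist z y = h <;> simp [h1, h2, h3]
    rw [LinearMap.sum_apply, Finsupp.finsetSum_apply, Finset.sum_congr rfl fun p _ => hterm p,
      Finset.sum_ite_eq', if_pos, hM]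
    simp [S, hammingDist_le]
  rw [hsum]
  exact sum_mem fun p _ => (T κ).smul_mem
    (mul_mem (mul_mem (hE _) (distMap_mem_T κ _)) (hE _)) _

/-! ### Invariance of the subconstituent algebra -/

theorem aut_flip (g : cube N ≃g cube N) (x : Vertex N) :
    ∑ i, (vtx (g (flip x i)) : V N) = ∑ i, vtx (flip (g x) i) := by
  have h : ∀ x : Vertex N,
      ∑ i, (vtx (flip x i) : V N) = ∑ y with (cube N).Adj x y, vtx y := by
    intro x
    rw [← SimpleGraph.neighborFinset_eq_filter, cube_neighborFinset, Finset.sum_map]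
    rfl
  have h' := congrArg (autV g) (h x)
  simp only [map_sum, autV_vtx] at h'
  rw [h', h]
  refine Finset.sum_equiv g.toEquiv (fun y => ?_) fun y _ => rfl
  simpa using (g.map_adj_iff (v := x) (w := y)).symm

theorem autV_apply (g : cube N ≃g cube N) (v : V N) (x : Vertex N) : autV g v (g x) = v x :=
  Finsupp.mapDomain_apply g.injective v x

/-- It suffices to check generators: `adjMap` commutes with every automorphism, and `dualAdjMap κ`
with those fixing κ, as they preserve the distance to κ. -/
theorem autV_mul_of_mem_T {κ : Vertex N} {M : Module.End ℂ (V N)} (hM : M ∈ T κ)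
    {g : cube N ≃g cube N} (hg : g κ = κ) : autV g * M = M * autV g := by
  induction hM using Algebra.adjoin_induction with
  | mem x hx =>
    refine (stdBasis N).ext fun z => ?_
    rw [Finsupp.coe_basisSingleOne, Module.End.mul_apply, Module.End.mul_apply, autV_vtx]
    rcases hx with rfl | rfl
    · rw [adjMap_vtx, adjMap_vtx, map_sum, ← aut_flip]
      simp only [autV_vtx]
    · rw [dualAdjMap_vtx, dualAdjMap_vtx, map_smul, autV_vtx]
      have hd : hammingDist (g z) κ = hammingDist z κ := by
        simpa only [hg] using hammingDist_aut g z κ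
      rw [hd]
  | algebraMap r => exact (Algebra.commutes r (autV g)).symm
  | add x y _ _ hx hy => rw [mul_add, add_mul, hx, hy]
  | mul x y _ _ hx hy => rw [← mul_assoc, hx, mul_assoc, hy, mul_assoc]

theorem entry_aut_of_mem_T {κ : Vertex N} {M : Module.End ℂ (V N)} (hM : M ∈ T κ)
    {g : cube N ≃g cube N} (hg : g κ = κ) (y z : Vertex N) :
    M (vtx (g z)) (g y) = M (vtx z) y := by
  have h := LinearMap.congr_fun (autV_mul_of_mem_T hM hg) (vtx z)
  rw [Module.End.mul_apply, Module.End.mul_apply, autV_vtx] at h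
  rw [← h, autV_apply]

/-! ### The fixed space -/

theorem tensorBasis_repr_autV3 (g : cube N ≃g cube N) (u : V3 N) (x y z : Vertex N) :
    (tensorBasis N).repr (autV3 g u) (g x, g y, g z) = (tensorBasis N).repr u (x, y, z) := by
  have h : (tensorBasis N).coord (g x, g y, g z) ∘ₗ autV3 g = (tensorBasis N).coord (x, y, z) := by
    refine (tensorBasis N).ext ?_
    rintro ⟨a, b, c⟩
    have : autV3 g (tensorBasis N (a, b, c)) = tensorBasis N (g a, g b, g c) := by
      simp only [tensorBasis_apply, autV3, TensorProduct.map_tmul, autV_vtx]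
    rw [LinearMap.comp_apply, this]
    simp [Finsupp.single_apply]
  exact LinearMap.congr_fun h u

theorem mem_Fix_iff {u : V3 N} : u ∈ Fix N ↔ ∀ (g : cube N ≃g cube N) (x y z : Vertex N),
    (tensorBasis N).repr u (g x, g y, g z) = (tensorBasis N).repr u (x, y, z) := by
  constructor
  · intro hu g x y z
    have h := tensorBasis_repr_autV3 g u x y z
    rwa [hu g] at h
  · intro h g
    refine (tensorBasis N).repr.injective (Finsupp.ext ?_)
    rintro ⟨x, y, z⟩
    obtain ⟨x, rfl⟩ := g.surjective x
    obtain ⟨y, rfl⟩ := g.surjective y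
    obtain ⟨z, rfl⟩ := g.surjective z
    rw [tensorBasis_repr_autV3, h]

theorem epsilon_entry (κ : Vertex N) (u : V3 N) (y z : Vertex N) :
    epsilon κ u (vtx z) y =
      (((2 : ℝ) ^ ((N : ℝ) / 2) : ℝ) : ℂ) * (tensorBasis N).repr u (κ, y, z) := by
  rw [← endBasis_repr]
  have h : (endBasis N).coord (y, z) ∘ₗ epsilon κ =
      (((2 : ℝ) ^ ((N : ℝ) / 2) : ℝ) : ℂ) • (tensorBasis N).coord (κ, y, z) := by
    refine (tensorBasis N).ext ?_
    rintro ⟨a, b, c⟩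
    rw [LinearMap.comp_apply, tensorBasis_apply, epsilon_apply, ← tensorBasis_apply,
      ← endBasis_apply]
    by_cases ha : a = κ
    · simp [ha, Finsupp.single_apply]
    · simp [ha]
  exact LinearMap.congr_fun h u

theorem two_rpow_half_ne_zero (N : ℕ) : (((2 : ℝ) ^ ((N : ℝ) / 2) : ℝ) : ℂ) ≠ 0 :=
  Complex.ofReal_ne_zero.2 (Real.rpow_pos_of_pos two_pos _).ne'

theorem two_rpow_half_mul_self (N : ℕ) :
    (((2 : ℝ) ^ ((N : ℝ) / 2) : ℝ) : ℂ) * (((2 : ℝ) ^ ((N : ℝ) / 2) : ℝ) : ℂ) = 2 ^ N := by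
  rw [← Complex.ofReal_mul, ← Real.rpow_add two_pos, add_halves, Real.rpow_natCast]
  simp

theorem epsilon_mem_T (κ : Vertex N) {u : V3 N} (hu : u ∈ Fix N) : epsilon κ u ∈ T κ := by
  have hf : Function.FactorsThrough (fun p : Vertex N × Vertex N => epsilon κ u (vtx p.2) p.1)
      (fun p => (hammingDist p.1 κ, hammingDist p.2 κ, hammingDist p.2 p.1)) := by
    rintro ⟨y, z⟩ ⟨y', z'⟩ h
    simp only [Prod.mk.injEq] at h
    obtain ⟨hy, hz, hyz⟩ := h
    rw [hammingDist_comm z, hammingDist_comm z'] at hyz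
    obtain ⟨g, hg, rfl, rfl⟩ := exists_aut_of_dist_eq hy hz hyz
    simp only [epsilon_entry]
    nth_rw 1 [← hg]
    rw [mem_Fix_iff.1 hu]
  obtain ⟨F, hF⟩ := (Function.factorsThrough_iff _).1 hf
  exact mem_T_of_entries F fun y z => congrFun hF (y, z)

/-- Transitivity moves any triple to one starting at κ, where the coefficient is visible in the
image. -/
theorem epsilon_injOn (κ : Vertex N) : Set.InjOn (epsilon κ) (Fix N : Set (V3 N)) := by
  intro u hu v hv h
  refine (tensorBasis N).repr.injective (Finsupp.ext ?_)
  rintro ⟨x, y, z⟩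
  obtain ⟨g, rfl⟩ := exists_aut_map_eq x κ
  rw [← mem_Fix_iff.1 hu g, ← mem_Fix_iff.1 hv g]
  refine mul_left_cancel₀ (two_rpow_half_ne_zero N) ?_
  rw [← epsilon_entry, ← epsilon_entry, h]

/-- The slice prescribed by `M` is spread to every x through a chosen automorphism `t x` taking x to
κ; invariance of `M` under the stabilizer makes the choice immaterial. -/
theorem exists_epsilon_eq (κ : Vertex N) {M : Module.End ℂ (V N)} (hM : M ∈ T κ) :
    ∃ u ∈ Fix N, epsilon κ u = M := by
  choose t ht using fun x : Vertex N => exists_aut_map_eq x κ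
  let f : Vertex N × Vertex N × Vertex N → ℂ := fun p =>
    (((2 : ℝ) ^ ((N : ℝ) / 2) : ℝ) : ℂ)⁻¹ * M (vtx (t p.1 p.2.2)) (t p.1 p.2.1)
  let u : V3 N := (tensorBasis N).equivFun.symm f
  have hu : ∀ p, (tensorBasis N).repr u p = f p := fun p =>
    congrFun ((tensorBasis N).equivFun.apply_symm_apply f) p
  have hf : ∀ (g : cube N ≃g cube N) (x y z : Vertex N), f (g x, g y, g z) = f (x, y, z) := by
    intro g x y z
    -- The two transports of a triple, before and after applying g, differ by this element of the
    -- stabilizer of κ.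
    let s : cube N ≃g cube N := ((t x).symm.trans g).trans (t (g x))
    have hs : s κ = κ := by
      have : (t x).symm κ = x := by rw [← ht x, RelIso.symm_apply_apply]
      simp [s, this, ht]
    have hst : ∀ w, s (t x w) = t (g x) (g w) := fun w => by simp [s]
    simp only [f, ← hst, entry_aut_of_mem_T hM hs]
  refine ⟨u, mem_Fix_iff.2 fun g x y z => ?_, end_ext fun y z => ?_⟩
  · rw [hu, hu, hf]
  · rw [epsilon_entry, hu, mul_inv_cancel_left₀ (two_rpow_half_ne_zero N)]
    -- `t κ` need not be the identity, but it fixes κ.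
    exact entry_aut_of_mem_T hM (ht κ) y z

theorem tensorForm_eq_endForm (κ : Vertex N) {u v : V3 N} (hu : u ∈ Fix N) (hv : v ∈ Fix N) :
    tensorForm N u v = endForm N (epsilon κ u) (epsilon κ v) := by
  let f : Vertex N → Vertex N × Vertex N → ℂ := fun x p =>
    (tensorBasis N).repr u (x, p) * (starRingEnd ℂ) ((tensorBasis N).repr v (x, p))
  have hx : ∀ x, ∑ p, f x p = ∑ p, f κ p := by
    intro x
    obtain ⟨g, rfl⟩ := exists_aut_map_eq x κ
    refine Fintype.sum_equiv (g.toEquiv.prodCongr g.toEquiv) _ _ ?_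
    rintro ⟨y, z⟩
    simp only [f]
    rw [← mem_Fix_iff.1 hu g, ← mem_Fix_iff.1 hv g]
    rfl
  have hl : tensorForm N u v = 2 ^ N * ∑ p, f κ p := by
    rw [tensorForm, orthonormalForm, Fintype.sum_prod_type]
    refine (Finset.sum_congr rfl fun x _ => hx x).trans ?_
    simp
  rw [hl, endForm, orthonormalForm, Finset.mul_sum]
  refine Finset.sum_congr rfl ?_
  rintro ⟨y, z⟩ -
  rw [endBasis_repr, endBasis_repr, epsilon_entry, epsilon_entry, map_mul, Complex.conj_ofReal,
    mul_mul_mul_comm, two_rpow_half_mul_self]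

end Hypercube

end

theorem mainTheorem7 (N : ℕ) (κ : Hypercube.Vertex N) :
    Set.BijOn (Hypercube.epsilon κ) (Hypercube.Fix N : Set (Hypercube.V3 N))
        (Hypercube.T κ : Set (Module.End ℂ (Hypercube.V N))) ∧
      ∀ u ∈ Hypercube.Fix N, ∀ v ∈ Hypercube.Fix N,
        Hypercube.tensorForm N u v =
          Hypercube.endForm N (Hypercube.epsilon κ u) (Hypercube.epsilon κ v) :=
  ⟨⟨fun _ hu => Hypercube.epsilon_mem_T κ hu, Hypercube.epsilon_injOn κ,
    fun _ hM => Hypercube.exists_epsilon_eq κ hM⟩,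
    fun _ hu _ hv => Hypercube.tensorForm_eq_endForm κ hu hv⟩
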